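/- A \emph{dimension function} is an increasing (not necessarily strictly), right-continuous map $h:[0,\infty)\to[0,\infty)$ with $h(0)=0$ and $h(t)>0$ for $t>0$. Write $h\prec x$ if $\lim_{t\to 0^+} t/h(t)=0$. For $E\subseteq\mathbb{R}$ let $$\mathcal{H}^h(E)=\lim_{\delta\to0^+}\inf\Big\{\sum_{i} h(\operatorname{diam} U_i) : E\subseteq\bigcup_{i\in\mathbb N} U_i,\ \operatorname{diam}U_i\le\delta \text{ for all } i\Big\}$$ be the Hausdorff measure associated with $h$. (i) For every dimension function $h$ with $h\prec x$ and every countable set $A\subseteq(1,+\infty)$ there exists a compact set $E\subseteq\mathbb{R}$ with $\mathcal{H}^h(E)>0$ such that $$\frac{z-x}{z-y}\notin A\qquad\text{for all } x<y<z \text{ in } E.$$ (ii) In particular (taking $A=\{2\}$), for every dimension function $h$ with $h\prec x$ there exists a compact set $E\subseteq\mathbb{R}$ with $\mathcal{H}^h(E)>0$ that contains no (non-trivial) arithmetic progression of length $3$. (iii) Consequently there exists a compact set $E\subseteq\mathbb{R}$ of Hausdorff dimension $1$ that contains no (non-trivial) arithmetic progression of length $3$ (Keleti's theorem). -/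

import Mathlib

open Set Filter Topology MeasureTheory
open scoped NNReal ENNReal

/-- A dimension function: a map `h : [0, ∞) → [0, ∞)` with `h 0 = 0` and `h t > 0` for `t > 0`,
which is increasing (in the weak sense) and right-continuous. -/
structure IsDimensionFunction (h : ℝ≥0 → ℝ≥0) : Prop where
  map_zero : h 0 = 0
  pos : ∀ t, 0 < t → 0 < h t
  mono : Monotone h
  right_continuous : ∀ t, ContinuousWithinAt h (Ici t) t

/-- The order on dimension functions: `h₂ ≺ h₁` if `h₁ x / h₂ x → 0` as `x → 0⁺`. -/
def DimPrec (h₂ h₁ : ℝ≥0 → ℝ≥0) : Prop :=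
  Tendsto (fun x => h₁ x / h₂ x) (𝓝[>] 0) (𝓝 0)

/-- The Hausdorff measure `𝓗^h` associated with `h`: the limit as `δ → 0` of the infimum of
`∑ h (diam Uᵢ)` over the countable coverings by sets of diameter at most `δ`.
The value assigned to an infinite diameter plays no role in the limit `δ → 0`. -/
noncomputable def hausdorffMeasureOf {X : Type*} [EMetricSpace X] [MeasurableSpace X]
    [BorelSpace X] (h : ℝ≥0 → ℝ≥0) : Measure X :=
  Measure.mkMetric fun r : ℝ≥0∞ => if r = ∞ then ∞ else (h r.toNNReal : ℝ≥0∞)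

/-! The ratio `(z - x) / (z - y)` equals `a` iff `x + (a - 1) * z = a * y`. For rationals `p`, `q`
separating the three points, this is excluded by a congruence: if `N * x` and `N * (a - 1) * z` are
within `1/8` of integers and `N * a * y` is within `1/8` of a half-integer, the errors add up to at
most `3/8 < 1/2`. The set `E` is the intersection of `[0, 1]` with one such `sieve` for each of the
countably many triples `(a, p, q)`, each with its own `N`.

That `E` is large is shown by a measure on it. Each sieve carries a density bounded by `8` whose
deviation from `1` has integral `O(1/N)` over every interval. The product `f k` of the first `k`
densities is at most `8 ^ k`, and taking `N` large makes each new factor change interval integrals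
as little as desired (`exists_density_seq`). The limit measure gives an interval of length `t` mass
at most `8 ^ j * t + R (j + 1)`, which is below `h t` for `R (j + 1) < t ≤ R j` if the scales `R`
decrease fast enough; this is where `h ≺ x` enters. The mass distribution principle
(`stieltjes_measure_le_hausdorffMeasureOf`) concludes. -/

/-! ### Tame multipliers. -/

/-- A bounded measurable function `f` is tame if multiplication by `f` preserves smallness of the
integrals over all intervals. -/
structure IsTame (f : ℝ → ℝ) : Prop where
  measurable : Measurable f
  bounded : ∃ B, ∀ x, |f x| ≤ B
  integral_mul : ∃ K, ∀ u : ℝ → ℝ, (∀ a b, IntervalIntegrable u volume a b) → ∀ σ,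
    (∀ a b, a ≤ b → |∫ x in a..b, u x| ≤ σ) → ∀ a b, a ≤ b → |∫ x in a..b, f x * u x| ≤ K * σ

theorem intervalIntegrable_mul_of_bounded {f u : ℝ → ℝ} (hf : Measurable f)
    (hb : ∃ B, ∀ x, |f x| ≤ B) {a b : ℝ} (hu : IntervalIntegrable u volume a b) :
    IntervalIntegrable (fun x => f x * u x) volume a b := by
  obtain ⟨B, hB⟩ := hb
  rw [intervalIntegrable_iff] at hu ⊢
  exact hu.bdd_mul (c := B) hf.aestronglyMeasurable (ae_of_all _ hB)

theorem intervalIntegrable_of_measurable_of_bounded {f : ℝ → ℝ} (hf : Measurable f)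
    (hb : ∃ B, ∀ x, |f x| ≤ B) (a b : ℝ) : IntervalIntegrable f volume a b := by
  simpa using intervalIntegrable_mul_of_bounded hf hb
    (intervalIntegrable_const (μ := volume) (c := (1 : ℝ)) (a := a) (b := b))

namespace IsTame

theorem const (c : ℝ) : IsTame fun _ => c where
  measurable := measurable_const
  bounded := ⟨|c|, fun _ => le_rfl⟩
  integral_mul := ⟨|c|, fun u _ σ hσ a b hab => by
    rw [intervalIntegral.integral_const_mul, abs_mul]
    exact mul_le_mul_of_nonneg_left (hσ a b hab) (abs_nonneg c)⟩

theorem add {f g : ℝ → ℝ} (hf : IsTame f) (hg : IsTame g) : IsTame fun x => f x + g x where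
  measurable := hf.measurable.add hg.measurable
  bounded := by
    obtain ⟨B, hB⟩ := hf.bounded
    obtain ⟨C, hC⟩ := hg.bounded
    exact ⟨B + C, fun x => (abs_add_le _ _).trans (add_le_add (hB x) (hC x))⟩
  integral_mul := by
    obtain ⟨K, hK⟩ := hf.integral_mul
    obtain ⟨M, hM⟩ := hg.integral_mul
    refine ⟨K + M, fun u hu σ hσ a b hab => ?_⟩
    simp only [add_mul]
    rw [intervalIntegral.integral_add
      (intervalIntegrable_mul_of_bounded hf.measurable hf.bounded (hu a b))
      (intervalIntegrable_mul_of_bounded hg.measurable hg.bounded (hu a b))]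
    exact (abs_add_le _ _).trans (add_le_add (hK u hu σ hσ a b hab) (hM u hu σ hσ a b hab))

theorem mul {f g : ℝ → ℝ} (hf : IsTame f) (hg : IsTame g) : IsTame fun x => f x * g x where
  measurable := hf.measurable.mul hg.measurable
  bounded := by
    obtain ⟨B, hB⟩ := hf.bounded
    obtain ⟨C, hC⟩ := hg.bounded
    refine ⟨B * C, fun x => ?_⟩
    rw [abs_mul]
    exact mul_le_mul (hB x) (hC x) (abs_nonneg _) ((abs_nonneg _).trans (hB x))
  integral_mul := by
    obtain ⟨K, hK⟩ := hf.integral_mul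
    obtain ⟨M, hM⟩ := hg.integral_mul
    refine ⟨K * M, fun u hu σ hσ a b hab => ?_⟩
    simp only [mul_assoc]
    exact hK _ (fun a b => intervalIntegrable_mul_of_bounded hg.measurable hg.bounded (hu a b)) _
      (hM u hu σ hσ) a b hab

theorem sum {ι : Type*} (s : Finset ι) {f : ι → ℝ → ℝ} (hf : ∀ i, IsTame (f i)) :
    IsTame fun x => ∑ i ∈ s, f i x := by
  classical
  induction s using Finset.induction_on with
  | empty => simpa using const 0
  | insert i s hi ih =>
    simp only [Finset.sum_insert hi]
    exact (hf i).add ih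

theorem one_sub {f : ℝ → ℝ} (hf : IsTame f) : IsTame fun x => 1 - f x := by
  convert! (const 1).add ((const (-1)).mul hf) using 2
  ring

end IsTame

/-- The indicator function of the half-line `(c, ∞)`. -/
noncomputable def step (c : ℝ) : ℝ → ℝ := (Ioi c).indicator 1

theorem step_of_lt {c x : ℝ} (h : c < x) : step c x = 1 := by simp [step, h]

theorem step_of_le {c x : ℝ} (h : x ≤ c) : step c x = 0 := by simp [step, h]

theorem isTame_step (c : ℝ) : IsTame (step c) where
  measurable := measurable_one.indicator measurableSet_Ioi
  bounded := ⟨1, fun x => by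
    rcases lt_or_ge c x with h | h
    · simp [step_of_lt h]
    · simp [step_of_le h]⟩
  integral_mul := by
    refine ⟨1, fun u _ σ hσ a b hab => ?_⟩
    -- Multiplying by a step only truncates the interval of integration.
    have key : ∫ x in a..b, step c x * u x = ∫ x in (max a c)..(max b c), u x := by
      have e : (fun x => step c x * u x) = (Ioi c).indicator u := by
        ext x
        by_cases h : x ∈ Ioi c <;> simp [step, h]
      rw [e, intervalIntegral.integral_of_le hab,
        intervalIntegral.integral_of_le (max_le_max_right c hab),
        setIntegral_indicator measurableSet_Ioi, Ioc_inter_Ioi]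
      rcases le_total c b with h | h
      · rw [max_eq_left h]
      · rw [Ioc_eq_empty_of_le (h.trans (le_max_right _ _)), max_eq_right h,
          Ioc_eq_empty_of_le (le_max_right _ _)]
    rw [key, one_mul]
    exact hσ _ _ (max_le_max_right c hab)

/-- The indicator function of `(0, 1]`. -/
noncomputable def unitStep (x : ℝ) : ℝ := step 0 x * (1 - step 1 x)

theorem isTame_unitStep : IsTame unitStep := (isTame_step 0).mul (isTame_step 1).one_sub

theorem unitStep_of_mem {x : ℝ} (h : x ∈ Ioc (0 : ℝ) 1) : unitStep x = 1 := by
  simp [unitStep, step_of_lt h.1, step_of_le h.2]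

theorem unitStep_of_notMem {x : ℝ} (h : x ∉ Ioc (0 : ℝ) 1) : unitStep x = 0 := by
  rcases le_or_gt x 0 with h0 | h0
  · simp [unitStep, step_of_le h0]
  · simp [unitStep, step_of_lt (not_le.1 fun h1 => h ⟨h0, h1⟩)]

theorem Int.eq_sum_ite_lt {k M : ℤ} (h₁ : -M ≤ k) (h₂ : k ≤ M) :
    k = -M + ∑ j ∈ Finset.Ico (-M) M, if j < k then 1 else 0 := by
  have e : (Finset.Ico (-M) M).filter (· < k) = Finset.Ico (-M) k := by
    ext j
    simp only [Finset.mem_filter, Finset.mem_Ico]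
    omega
  rw [← Finset.sum_filter, e, Finset.sum_const, Int.card_Ico, nsmul_eq_mul, mul_one]
  omega

/-- On `(0, 1]` the ceiling takes finitely many values, so it is a finite sum of steps. The cutoff
is essential: the ceiling is unbounded on the line. -/
theorem isTame_unitStep_mul_ceil {α : ℝ} (hα : 0 < α) (β : ℝ) :
    IsTame fun t => unitStep t * (⌈α * t + β⌉ : ℝ) := by
  set M : ℤ := ⌈α + |β|⌉ + 1
  have key : (fun t => unitStep t * (⌈α * t + β⌉ : ℝ)) = fun t => unitStep t *
      ((-M : ℝ) + ∑ j ∈ Finset.Ico (-M) M, step ((j - β) / α) t) := by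
    ext t
    by_cases ht : t ∈ Ioc (0 : ℝ) 1
    · have hαt : α * t ≤ α := by nlinarith [ht.2]
      have hαt0 : 0 < α * t := mul_pos hα ht.1
      have hM : α + |β| ≤ (⌈α + |β|⌉ : ℝ) := Int.le_ceil _
      have h₁ : -M ≤ ⌈α * t + β⌉ := by
        apply (Int.cast_le (R := ℝ)).1
        refine le_trans ?_ (Int.le_ceil _)
        push_cast [M]
        linarith [neg_abs_le β]
      have h₂ : ⌈α * t + β⌉ ≤ M := by
        apply Int.ceil_le.2
        push_cast [M]
        linarith [le_abs_self β]
      congr 1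
      conv_lhs => rw [Int.eq_sum_ite_lt h₁ h₂]
      push_cast
      congr 1
      refine Finset.sum_congr rfl fun j _ => ?_
      have : j < ⌈α * t + β⌉ ↔ (j - β) / α < t := by
        rw [Int.lt_ceil, div_lt_iff₀ hα, mul_comm t, sub_lt_iff_lt_add]
      by_cases h : j < ⌈α * t + β⌉
      · rw [if_pos h, step_of_lt (this.1 h)]
      · rw [if_neg h, step_of_le (not_lt.1 (mt this.2 h))]
    · simp [unitStep_of_notMem ht]
  rw [key]
  exact isTame_unitStep.mul ((IsTame.const _).add (IsTame.sum _ fun j => isTame_step _))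

/-! ### The comb and its oscillation. -/

/-- The `1`-periodic function equal to `8` on the points at distance less than `1 / 8` to the left
of an integer, and to `0` elsewhere. -/
noncomputable def comb (t : ℝ) : ℝ := 8 * ((⌈t + 1 / 8⌉ : ℝ) - ⌈t⌉)

theorem comb_eq_zero_or (t : ℝ) :
    comb t = 0 ∨ comb t = 8 ∧ ∃ n : ℤ, t ≤ n ∧ (n : ℝ) < t + 1 / 8 := by
  have h₁ : ⌈t⌉ ≤ ⌈t + 1 / 8⌉ := Int.ceil_mono (by linarith)
  have h₂ : ⌈t + 1 / 8⌉ ≤ ⌈t⌉ + 1 := by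
    rw [← Int.ceil_add_one]
    exact Int.ceil_mono (by linarith)
  rcases h₁.eq_or_lt with h | h
  · left
    simp [comb, h]
  · right
    refine ⟨?_, ⌈t⌉, Int.le_ceil t, Int.lt_ceil.1 h⟩
    have : ⌈t + 1 / 8⌉ = ⌈t⌉ + 1 := by omega
    rw [comb, this]
    push_cast
    ring

theorem comb_nonneg (t : ℝ) : 0 ≤ comb t := by
  rcases comb_eq_zero_or t with h | ⟨h, -⟩ <;> simp [h]

theorem comb_le (t : ℝ) : comb t ≤ 8 := by
  rcases comb_eq_zero_or t with h | ⟨h, -⟩ <;> simp [h]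

theorem abs_sub_round_le_of_comb_ne_zero {t : ℝ} (h : comb t ≠ 0) : |t - round t| ≤ 1 / 8 := by
  obtain ⟨-, n, h₁, h₂⟩ := (comb_eq_zero_or t).resolve_left h
  refine (round_le t n).trans ?_
  rw [abs_le]
  constructor <;> linarith

theorem measurable_comb : Measurable comb := by
  unfold comb
  fun_prop

theorem comb_periodic : Function.Periodic comb 1 := fun t => by
  have : t + 1 + 1 / 8 = t + 1 / 8 + 1 := by ring
  simp only [comb, this, Int.ceil_add_one]
  push_cast
  ring

theorem intervalIntegrable_comb_sub_one (a b : ℝ) :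
    IntervalIntegrable (fun t => comb t - 1) volume a b :=
  intervalIntegrable_of_measurable_of_bounded (measurable_comb.sub_const 1)
    ⟨8, fun t => abs_le.2 ⟨by linarith [comb_nonneg t], by linarith [comb_le t]⟩⟩ a b

theorem integral_comb_sub_one : ∫ t in (0 : ℝ)..1, (comb t - 1) = 0 := by
  have h₁ : ∫ t in (0 : ℝ)..(7 / 8), (comb t - 1) = ∫ t in (0 : ℝ)..(7 / 8), (-1 : ℝ) := by
    refine intervalIntegral.integral_congr_ae (ae_of_all _ fun t ht => ?_)
    rw [uIoc_of_le (by norm_num)] at ht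
    have e₁ : ⌈t⌉ = 1 := Int.ceil_eq_iff.2 ⟨by simpa using ht.1, by push_cast; linarith [ht.2]⟩
    have e₂ : ⌈t + 1 / 8⌉ = 1 :=
      Int.ceil_eq_iff.2 ⟨by push_cast; linarith [ht.1], by push_cast; linarith [ht.2]⟩
    simp only [comb, e₁, e₂]
    norm_num
  have h₂ : ∫ t in (7 / 8 : ℝ)..1, (comb t - 1) = ∫ t in (7 / 8 : ℝ)..1, (7 : ℝ) := by
    refine intervalIntegral.integral_congr_ae (ae_of_all _ fun t ht => ?_)
    rw [uIoc_of_le (by norm_num)] at ht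
    have e₁ : ⌈t⌉ = 1 :=
      Int.ceil_eq_iff.2 ⟨by push_cast; linarith [ht.1], by push_cast; linarith [ht.2]⟩
    have e₂ : ⌈t + 1 / 8⌉ = 2 :=
      Int.ceil_eq_iff.2 ⟨by push_cast; linarith [ht.1], by push_cast; linarith [ht.2]⟩
    simp only [comb, e₁, e₂]
    norm_num
  rw [← intervalIntegral.integral_add_adjacent_intervals (intervalIntegrable_comb_sub_one 0 (7 / 8))
    (intervalIntegrable_comb_sub_one _ _), h₁, h₂]
  norm_num

/-- Having mean zero over a period, `comb - 1` has a periodic primitive, so one period suffices. -/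
theorem abs_integral_comb_sub_one_le (x : ℝ) : |∫ t in (0 : ℝ)..x, (comb t - 1)| ≤ 8 := by
  have hp : Function.Periodic (fun t => comb t - 1) 1 := fun t => by simp [comb_periodic t]
  have hV : Function.Periodic (fun x => ∫ t in (0 : ℝ)..x, (comb t - 1)) 1 := fun x => by
    beta_reduce
    rw [← intervalIntegral.integral_add_adjacent_intervals (intervalIntegrable_comb_sub_one 0 x)
      (intervalIntegrable_comb_sub_one _ _), hp.intervalIntegral_add_eq x 0, zero_add,
      integral_comb_sub_one, add_zero]
  obtain ⟨y, hy, hxy⟩ := hV.exists_mem_Ico₀ one_pos x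
  rw [hxy]
  refine (intervalIntegral.norm_integral_le_of_norm_le_const (f := fun t => comb t - 1) (C := 8)
    fun t _ => ?_).trans ?_
  · exact abs_le.2 ⟨by linarith [comb_nonneg t], by linarith [comb_le t]⟩
  · rw [sub_zero, abs_of_nonneg hy.1]
    linarith [hy.2]

theorem abs_integral_comb_comp_sub_one_le {α : ℝ} (hα : 0 < α) (β a b : ℝ) :
    |∫ t in a..b, (comb (α * t + β) - 1)| ≤ 16 / α := by
  rw [intervalIntegral.integral_comp_mul_add (fun t => comb t - 1) hα.ne' β, smul_eq_mul, abs_mul,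
    abs_of_pos (inv_pos.2 hα), div_eq_inv_mul]
  refine mul_le_mul_of_nonneg_left ?_ (inv_pos.2 hα).le
  rw [← intervalIntegral.integral_interval_sub_left (intervalIntegrable_comb_sub_one 0 _)
    (intervalIntegrable_comb_sub_one 0 _)]
  refine (abs_sub _ _).trans ?_
  linarith [abs_integral_comb_sub_one_le (α * b + β), abs_integral_comb_sub_one_le (α * a + β)]

theorem isTame_unitStep_mul_comb {α : ℝ} (hα : 0 < α) (β : ℝ) :
    IsTame fun t => unitStep t * comb (α * t + β) := by
  have h := (IsTame.const 8).mul ((isTame_unitStep_mul_ceil hα (β + 1 / 8)).add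
    ((IsTame.const (-1)).mul (isTame_unitStep_mul_ceil hα β)))
  convert! h using 2 with t
  simp only [comb, ← add_assoc]
  ring

/-! ### The sieve for one triple `(a, p, q)`. -/

/-- The density that is carried by the set `sieve a p q N` and has mean value `1`. -/
noncomputable def sieveDensity (a p q : ℝ) (N : ℕ) (t : ℝ) : ℝ :=
  (1 - step p t) * comb (N * t) + step p t * (1 - step q t) * comb (N * a * t + 1 / 2) +
    step p t * step q t * comb (N * (a - 1) * t)

/-- A closed set in which no `x < p < y < q < z` satisfy `x + (a - 1) * z = a * y`: to the left of
`p`, between `p` and `q`, and to the right of `q`, it consists of the points for which `N * t`,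
`N * a * t + 1 / 2` and `N * (a - 1) * t`, respectively, are close to an integer. -/
def sieve (a p q : ℝ) (N : ℕ) : Set ℝ :=
  {t | t ≤ p ∧ ‖((N * t : ℝ) : UnitAddCircle)‖ ≤ 1 / 8} ∪
    {t | p ≤ t ∧ t ≤ q ∧ ‖((N * a * t + 1 / 2 : ℝ) : UnitAddCircle)‖ ≤ 1 / 8} ∪
    {t | q ≤ t ∧ ‖((N * (a - 1) * t : ℝ) : UnitAddCircle)‖ ≤ 1 / 8}

theorem isClosed_sieve (a p q : ℝ) (N : ℕ) : IsClosed (sieve a p q N) := by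
  have h (α β : ℝ) : IsClosed {t : ℝ | ‖((α * t + β : ℝ) : UnitAddCircle)‖ ≤ 1 / 8} := by
    refine isClosed_le (continuous_norm.comp
      ((AddCircle.continuous_mk' (1 : ℝ)).comp (by fun_prop))) continuous_const
  have h₁ := h N 0
  have h₃ := h (N * (a - 1)) 0
  simp only [add_zero] at h₁ h₃
  exact ((isClosed_Iic.inter h₁).union (isClosed_Ici.inter (isClosed_Iic.inter (h _ _)))).union
    (isClosed_Ici.inter h₃)

theorem ne_of_mem_sieve {a p q x y z : ℝ} {N : ℕ} (hx : x ∈ sieve a p q N)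
    (hy : y ∈ sieve a p q N) (hz : z ∈ sieve a p q N) (hxp : x < p) (hpy : p < y) (hyq : y < q)
    (hqz : q < z) : x + (a - 1) * z ≠ a * y := by
  intro h
  replace hx : ‖((N * x : ℝ) : UnitAddCircle)‖ ≤ 1 / 8 := by
    rcases hx with (⟨-, h⟩ | ⟨h, -⟩) | ⟨h, -⟩
    · exact h
    all_goals linarith
  replace hy : ‖((N * a * y + 1 / 2 : ℝ) : UnitAddCircle)‖ ≤ 1 / 8 := by
    rcases hy with (⟨h, -⟩ | ⟨-, -, h⟩) | ⟨h, -⟩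
    · linarith
    · exact h
    · linarith
  replace hz : ‖((N * (a - 1) * z : ℝ) : UnitAddCircle)‖ ≤ 1 / 8 := by
    rcases hz with (⟨h, -⟩ | ⟨-, h, -⟩) | ⟨-, h⟩
    · linarith
    · linarith
    · exact h
  rw [UnitAddCircle.norm_eq, abs_le] at hx hy hz
  set i := round (N * x : ℝ)
  set j := round (N * a * y + 1 / 2 : ℝ)
  set k := round (N * (a - 1) * z : ℝ)
  have e : (N * x : ℝ) + N * (a - 1) * z = N * a * y := by linear_combination (N : ℝ) * h
  -- By `e`, the integer `j - i - k` differs from `1/2` by at most `3/8`.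
  have h₁ : ((j - i - k : ℤ) : ℝ) < (1 : ℤ) := by
    push_cast
    linarith [hx.1, hx.2, hy.1, hy.2, hz.1, hz.2]
  have h₂ : ((0 : ℤ) : ℝ) < (j - i - k : ℤ) := by
    push_cast
    linarith [hx.1, hx.2, hy.1, hy.2, hz.1, hz.2]
  rw [Int.cast_lt] at h₁ h₂
  omega

theorem sieveDensity_cases (a p q : ℝ) (N : ℕ) (t : ℝ) :
    (t ≤ p ∧ sieveDensity a p q N t = comb (N * t)) ∨
    (p ≤ t ∧ t ≤ q ∧ sieveDensity a p q N t = comb (N * a * t + 1 / 2)) ∨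
    (q ≤ t ∧ sieveDensity a p q N t = comb (N * (a - 1) * t)) := by
  rcases le_or_gt t p with h | h
  · left
    simp [sieveDensity, step_of_le h, h]
  · right
    rcases le_or_gt t q with h' | h'
    · left
      simp [sieveDensity, step_of_lt h, step_of_le h', h.le, h']
    · right
      simp [sieveDensity, step_of_lt h, step_of_lt h', h'.le]

theorem sieveDensity_nonneg (a p q : ℝ) (N : ℕ) (t : ℝ) : 0 ≤ sieveDensity a p q N t := by
  rcases sieveDensity_cases a p q N t with ⟨-, h⟩ | ⟨-, -, h⟩ | ⟨-, h⟩ <;>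
    exact h ▸ comb_nonneg _

theorem sieveDensity_le (a p q : ℝ) (N : ℕ) (t : ℝ) : sieveDensity a p q N t ≤ 8 := by
  rcases sieveDensity_cases a p q N t with ⟨-, h⟩ | ⟨-, -, h⟩ | ⟨-, h⟩ <;>
    exact h ▸ comb_le _

theorem mem_sieve_of_sieveDensity_ne_zero {a p q : ℝ} {N : ℕ} {t : ℝ}
    (ht : sieveDensity a p q N t ≠ 0) : t ∈ sieve a p q N := by
  simp only [sieve, UnitAddCircle.norm_eq]
  rcases sieveDensity_cases a p q N t with ⟨h₁, h⟩ | ⟨h₁, h₂, h⟩ | ⟨h₁, h⟩ <;> rw [h] at ht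
  · exact Or.inl (Or.inl ⟨h₁, abs_sub_round_le_of_comb_ne_zero ht⟩)
  · exact Or.inl (Or.inr ⟨h₁, h₂, abs_sub_round_le_of_comb_ne_zero ht⟩)
  · exact Or.inr ⟨h₁, abs_sub_round_le_of_comb_ne_zero ht⟩

theorem measurable_sieveDensity (a p q : ℝ) (N : ℕ) : Measurable (sieveDensity a p q N) := by
  have := (isTame_step p).measurable
  have := (isTame_step q).measurable
  have := measurable_comb
  unfold sieveDensity
  fun_prop

theorem isTame_unitStep_mul_sieveDensity {a : ℝ} (ha : 1 < a) (p q : ℝ) {N : ℕ} (hN : 0 < N) :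
    IsTame fun t => unitStep t * sieveDensity a p q N t := by
  have hN' : (0 : ℝ) < N := Nat.cast_pos.2 hN
  have h₁ := isTame_unitStep_mul_comb hN' 0
  have h₂ := isTame_unitStep_mul_comb (mul_pos hN' (by linarith : 0 < a)) (1 / 2)
  have h₃ := isTame_unitStep_mul_comb (mul_pos hN' (sub_pos.2 ha)) 0
  convert! (((isTame_step p).one_sub.mul h₁).add
    (((isTame_step p).mul (isTame_step q).one_sub).mul h₂)).add
    (((isTame_step p).mul (isTame_step q)).mul h₃) using 2 with t
  simp only [sieveDensity, add_zero]
  ring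

theorem exists_abs_integral_mul_comb_sub_one_le {f : ℝ → ℝ} (hf : IsTame f) {α : ℝ} (hα : 0 < α)
    (β : ℝ) : ∃ C, ∀ N : ℕ, 0 < N → ∀ a b, a ≤ b →
      |∫ t in a..b, f t * (comb (N * α * t + β) - 1)| ≤ C / N := by
  obtain ⟨K, hK⟩ := hf.integral_mul
  refine ⟨K * (16 / α), fun N hN a b hab => ?_⟩
  have hN' : (0 : ℝ) < N := Nat.cast_pos.2 hN
  refine (hK _ (fun a b => ?_) (16 / (N * α))
    (fun a b _ => abs_integral_comb_comp_sub_one_le (mul_pos hN' hα) β a b) a b hab).trans_eq ?_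
  · have := measurable_comb
    exact intervalIntegrable_of_measurable_of_bounded (by fun_prop)
      ⟨8, fun t => abs_le.2 ⟨by linarith [comb_nonneg (N * α * t + β)],
        by linarith [comb_le (N * α * t + β)]⟩⟩ a b
  · field_simp

theorem exists_abs_integral_sieveDensity_sub_one_le {a : ℝ} (ha : 1 < a) (p q : ℝ) :
    ∃ C, ∀ N : ℕ, 0 < N → ∀ x y, x ≤ y →
      |∫ t in x..y, (sieveDensity a p q N t - 1)| ≤ C / N := by
  have t₁ := (isTame_step p).one_sub
  have t₂ := (isTame_step p).mul (isTame_step q).one_sub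
  have t₃ := (isTame_step p).mul (isTame_step q)
  obtain ⟨C₁, h₁⟩ := exists_abs_integral_mul_comb_sub_one_le t₁ one_pos 0
  obtain ⟨C₂, h₂⟩ := exists_abs_integral_mul_comb_sub_one_le t₂ (by linarith : 0 < a) (1 / 2)
  obtain ⟨C₃, h₃⟩ := exists_abs_integral_mul_comb_sub_one_le t₃ (sub_pos.2 ha) 0
  refine ⟨C₁ + C₂ + C₃, fun N hN x y hxy => ?_⟩
  have hi {f : ℝ → ℝ} (hf : IsTame f) (α β : ℝ) :
      IntervalIntegrable (fun t => f t * (comb (N * α * t + β) - 1)) volume x y := by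
    have := measurable_comb
    exact intervalIntegrable_mul_of_bounded hf.measurable hf.bounded
      (intervalIntegrable_of_measurable_of_bounded (by fun_prop)
      ⟨8, fun t => abs_le.2 ⟨by linarith [comb_nonneg (N * α * t + β)],
        by linarith [comb_le (N * α * t + β)]⟩⟩ x y)
  have e : (fun t => sieveDensity a p q N t - 1) = fun t =>
      (1 - step p t) * (comb (N * 1 * t + 0) - 1) +
      step p t * (1 - step q t) * (comb (N * a * t + 1 / 2) - 1) +
      step p t * step q t * (comb (N * (a - 1) * t + 0) - 1) := by
    ext t
    simp only [sieveDensity, add_zero, mul_one]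
    ring
  rw [e, intervalIntegral.integral_add ((hi t₁ _ _).add (hi t₂ _ _)) (hi t₃ _ _),
    intervalIntegral.integral_add (hi t₁ _ _) (hi t₂ _ _), add_div, add_div]
  exact (abs_add_three _ _ _).trans
    (add_le_add_three (h₁ N hN x y hxy) (h₂ N hN x y hxy) (h₃ N hN x y hxy))

/-! ### Scales adapted to `h`. -/

theorem DimPrec.exists_mul_le {h : ℝ≥0 → ℝ≥0} (hh : IsDimensionFunction h)
    (hp : DimPrec h fun x => x) {c : ℝ} (hc : 0 < c) :
    ∃ ρ : ℝ, 0 < ρ ∧ ∀ t : ℝ≥0, 0 < t → (t : ℝ) ≤ ρ → c * t ≤ h t := by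
  lift c to ℝ≥0 using hc.le
  have h₁ : ∀ᶠ t in 𝓝[>] (0 : ℝ≥0), t / h t < c⁻¹ :=
    hp.eventually_lt_const (inv_pos.2 (by exact_mod_cast hc))
  obtain ⟨ρ, hρ, hsub⟩ := mem_nhdsGT_iff_exists_Ioc_subset.1 h₁
  refine ⟨ρ, by exact_mod_cast hρ, fun t ht htρ => ?_⟩
  have h₂ : t / h t < c⁻¹ := hsub ⟨ht, by exact_mod_cast htρ⟩
  rw [div_lt_iff₀ (hh.pos t ht), ← div_eq_inv_mul, lt_div_iff₀ (by exact_mod_cast hc)] at h₂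
  rw [mul_comm]
  exact_mod_cast h₂.le

/-- In the factor `8 ^ j + 1`, the term `8 ^ j` pays for the bound on the `j`-th density and the `1`
for the error `R (j + 1) < t` made in passing to the limit. -/
theorem DimPrec.exists_scales {h : ℝ≥0 → ℝ≥0} (hh : IsDimensionFunction h)
    (hp : DimPrec h fun x => x) :
    ∃ R : ℕ → ℝ, (∀ j, 0 < R j) ∧ StrictAnti R ∧ Tendsto R atTop (𝓝 0) ∧ R 0 ≤ 1 / 2 ∧
      ∀ j (t : ℝ≥0), 0 < t → (t : ℝ) ≤ R j → (8 ^ j + 1) * (t : ℝ) ≤ h t := by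
  choose ρ hρ hle using fun j : ℕ => hp.exists_mul_le hh (c := 8 ^ j + 1) (by positivity)
  let R : ℕ → ℝ := fun j => j.rec (min (ρ 0) (1 / 2)) fun j r => min (r / 2) (ρ (j + 1))
  have hR0 : R 0 = min (ρ 0) (1 / 2) := rfl
  have hRs (j : ℕ) : R (j + 1) = min (R j / 2) (ρ (j + 1)) := rfl
  have pos (j : ℕ) : 0 < R j := by
    induction j with
    | zero => exact lt_min (hρ 0) one_half_pos
    | succ j ih => exact lt_min (half_pos ih) (hρ _)
  have le (j : ℕ) : R j ≤ ρ j := by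
    cases j with
    | zero => exact min_le_left _ _
    | succ j => exact min_le_right _ _
  have le_half (j : ℕ) : R (j + 1) ≤ R j / 2 := min_le_left _ _
  have le_pow (j : ℕ) : R j ≤ (1 / 2) ^ j := by
    induction j with
    | zero => exact (min_le_right _ _).trans (by norm_num)
    | succ j ih =>
      rw [pow_succ]
      linarith [le_half j]
  refine ⟨R, pos, strictAnti_nat_of_succ_lt fun j => ?_, ?_, min_le_right _ _,
    fun j t ht htR => hle j t ht (htR.trans (le j))⟩
  · linarith [le_half j, pos j]
  · exact squeeze_zero (fun j => (pos j).le) le_pow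
      (tendsto_pow_atTop_nhds_zero_of_lt_one (by norm_num) (by norm_num))

/-! ### Product densities and their limit measure. -/

theorem exists_density_seq {g : ℕ → ℕ → ℝ → ℝ}
    (tame : ∀ k N, 0 < N → IsTame fun t => unitStep t * g k N t)
    (meas : ∀ k N, Measurable (g k N)) (nonneg : ∀ k N t, 0 ≤ g k N t) (le : ∀ k N t, g k N t ≤ 8)
    (mean : ∀ k, ∃ C, ∀ N : ℕ, 0 < N → ∀ a b, a ≤ b → |∫ t in a..b, (g k N t - 1)| ≤ C / N)
    {η : ℕ → ℝ} (hη : ∀ k, 0 < η k) :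
    ∃ (N : ℕ → ℕ) (f : ℕ → ℝ → ℝ), f 0 = unitStep ∧ (∀ k t, f (k + 1) t = f k t * g k (N k) t) ∧
      (∀ k, Measurable (f k)) ∧ (∀ k t, 0 ≤ f k t) ∧ (∀ k t, f k t ≤ 8 ^ k) ∧
      ∀ k a b, a ≤ b → |(∫ t in a..b, f (k + 1) t) - ∫ t in a..b, f k t| ≤ η k := by
  -- Vanishing off `(0, 1]` is carried along so that `f * g = f * (unitStep * g)`; the new factor
  -- then needs to be tame only after the cutoff.
  let P (f : ℝ → ℝ) : Prop := IsTame f ∧ ∀ t, f t = f t * unitStep t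
  have ex (k : ℕ) (f : {f // P f}) : ∃ f' : {f // P f}, ∃ N : ℕ,
      (∀ t, f'.1 t = f.1 t * g k N t) ∧
      ∀ a b, a ≤ b → |(∫ t in a..b, f'.1 t) - ∫ t in a..b, f.1 t| ≤ η k := by
    obtain ⟨f, hf, hfu⟩ := f
    obtain ⟨K, hK⟩ := hf.integral_mul
    obtain ⟨C, hC⟩ := mean k
    obtain ⟨N, hN, hN0⟩ : ∃ N : ℕ, K * (C / N) < η k ∧ 0 < N := by
      have : Tendsto (fun N : ℕ => K * (C / N)) atTop (𝓝 0) := by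
        simpa using (tendsto_const_div_atTop_nhds_zero_nat C).const_mul K
      exact ((this.eventually_lt_const (hη k)).and (eventually_gt_atTop 0)).exists
    have hg (a b : ℝ) : IntervalIntegrable (fun t => g k N t - 1) volume a b :=
      intervalIntegrable_of_measurable_of_bounded ((meas k N).sub_const 1)
        ⟨8, fun t => abs_le.2 ⟨by linarith [nonneg k N t], by linarith [le k N t]⟩⟩ a b
    have hfg : IsTame fun t => f t * g k N t := by
      convert! hf.mul (tame k N hN0) using 2 with t
      rw [← mul_assoc, ← hfu]
    refine ⟨⟨fun t => f t * g k N t, hfg, fun t => ?_⟩, N, fun t => rfl, fun a b hab => ?_⟩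
    · rw [mul_right_comm, ← hfu]
    · rw [← intervalIntegral.integral_sub
        (intervalIntegrable_of_measurable_of_bounded hfg.measurable hfg.bounded a b)
        (intervalIntegrable_of_measurable_of_bounded hf.measurable hf.bounded a b)]
      simp only [← mul_sub_one]
      exact (hK _ hg _ (hC N hN0) a b hab).trans hN.le
  choose F N hF hη' using ex
  have h0 : P unitStep := by
    refine ⟨isTame_unitStep, fun t => ?_⟩
    by_cases h : t ∈ Ioc (0 : ℝ) 1
    · simp [unitStep_of_mem h]
    · simp [unitStep_of_notMem h]
  let s : ℕ → {f // P f} := fun k => k.rec ⟨unitStep, h0⟩ F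
  have hmul (k : ℕ) (t : ℝ) : (s (k + 1)).1 t = (s k).1 t * g k (N k (s k)) t := hF k (s k) t
  have hnonneg (k : ℕ) (t : ℝ) : 0 ≤ (s k).1 t := by
    induction k with
    | zero =>
      change 0 ≤ unitStep t
      by_cases h : t ∈ Ioc (0 : ℝ) 1
      · simp [unitStep_of_mem h]
      · simp [unitStep_of_notMem h]
    | succ k ih => rw [hmul]; exact mul_nonneg ih (nonneg _ _ _)
  refine ⟨fun k => N k (s k), fun k => (s k).1, rfl, hmul, fun k => (s k).2.1.measurable, hnonneg,
    fun k t => ?_, fun k => hη' k (s k)⟩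
  induction k with
  | zero =>
    change unitStep t ≤ _
    by_cases h : t ∈ Ioc (0 : ℝ) 1
    · simp [unitStep_of_mem h]
    · simp [unitStep_of_notMem h]
  | succ k ih =>
    beta_reduce at ih ⊢
    rw [hmul, pow_succ]
    exact mul_le_mul ih (le _ _ _) (nonneg _ _ _) (by positivity)

/-- The allowed changes telescope. -/
theorem abs_sub_le_of_abs_succ_sub_le {x R : ℕ → ℝ}
    (h : ∀ k, |x (k + 1) - x k| ≤ R (k + 1) - R (k + 2)) (hR : ∀ k, 0 < R k) {j k : ℕ}
    (hjk : j ≤ k) : |x k - x j| ≤ R (j + 1) := by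
  have : |x k - x j| ≤ R (j + 1) - R (k + 1) := by
    induction k, hjk using Nat.le_induction with
    | base => simp
    | succ k _ ih =>
      have := abs_sub_le (x (k + 1)) (x k) (x j)
      linarith [h k]
  linarith [hR (k + 1)]

/-- The limit of the distribution functions of densities which change little. -/
theorem exists_limit_stieltjes {f : ℕ → ℝ → ℝ} {R : ℕ → ℝ} (hR : ∀ j, 0 < R j)
    (hR0 : Tendsto R atTop (𝓝 0)) (meas : ∀ k, Measurable (f k)) (nonneg : ∀ k t, 0 ≤ f k t)
    (le : ∀ k t, f k t ≤ 8 ^ k)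
    (close : ∀ k a b, a ≤ b →
      |(∫ t in a..b, f (k + 1) t) - ∫ t in a..b, f k t| ≤ R (k + 1) - R (k + 2)) :
    ∃ G : StieltjesFunction ℝ, Continuous G ∧
      (∀ a b, a ≤ b → Tendsto (fun k => ∫ t in a..b, f k t) atTop (𝓝 (G b - G a))) ∧
      ∀ j a b, a ≤ b → |G b - G a - ∫ t in a..b, f j t| ≤ R (j + 1) := by
  have hint (k : ℕ) (a b : ℝ) : IntervalIntegrable (f k) volume a b :=
    intervalIntegrable_of_measurable_of_bounded (meas k)
      ⟨8 ^ k, fun t => abs_le.2 ⟨by linarith [nonneg k t, (by positivity : (0 : ℝ) < 8 ^ k)],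
        le k t⟩⟩ a b
  have hclose (a b : ℝ) (hab : a ≤ b) (j k : ℕ) (hjk : j ≤ k) :
      |(∫ t in a..b, f k t) - ∫ t in a..b, f j t| ≤ R (j + 1) :=
    abs_sub_le_of_abs_succ_sub_le (x := fun k => ∫ t in a..b, f k t)
      (fun k => close k a b hab) hR hjk
  have hR1 : Tendsto (fun j => R (j + 1)) atTop (𝓝 0) := hR0.comp (tendsto_add_atTop_nat 1)
  have hlim (a b : ℝ) (hab : a ≤ b) : ∃ l, Tendsto (fun k => ∫ t in a..b, f k t) atTop (𝓝 l) := by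
    refine cauchySeq_tendsto_of_complete (cauchySeq_of_le_tendsto_0' _ (fun j k hjk => ?_) hR1)
    rw [dist_comm]
    exact hclose a b hab j k hjk
  have hlim0 (b : ℝ) : ∃ l, Tendsto (fun k => ∫ t in (0 : ℝ)..b, f k t) atTop (𝓝 l) := by
    rcases le_total 0 b with hb | hb
    · exact hlim 0 b hb
    · obtain ⟨l, hl⟩ := hlim b 0 hb
      refine ⟨-l, hl.neg.congr fun k => ?_⟩
      rw [intervalIntegral.integral_symm 0 b, neg_neg]
  choose G hG using hlim0
  have hGlim (a b : ℝ) : Tendsto (fun k => ∫ t in a..b, f k t) atTop (𝓝 (G b - G a)) :=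
    ((hG b).sub (hG a)).congr fun k =>
      intervalIntegral.integral_interval_sub_left (hint k 0 b) (hint k 0 a)
  have hGclose (j : ℕ) (a b : ℝ) (hab : a ≤ b) :
      |G b - G a - ∫ t in a..b, f j t| ≤ R (j + 1) :=
    le_of_tendsto ((hGlim a b).sub_const _).abs
      ((eventually_ge_atTop j).mono fun k hk => hclose a b hab j k hk)
  have hmono : Monotone G := fun a b hab => sub_nonneg.1 <| ge_of_tendsto' (hGlim a b) fun k =>
    intervalIntegral.integral_nonneg hab fun t _ => nonneg k t
  have hcont : Continuous G := by
    refine continuous_iff_continuousAt.2 fun x => Metric.continuousAt_iff.2 fun ε hε => ?_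
    -- Half of `ε` covers the distance to the `j`-th approximation, the other half its Lipschitz
    -- bound `8 ^ j`.
    obtain ⟨j, hj⟩ := (hR1.eventually_lt_const (half_pos hε)).exists
    have key (a b : ℝ) (hab : a ≤ b) (h : b - a < ε / 2 / 8 ^ j) : G b - G a < ε := by
      have h₁ : ∫ t in a..b, f j t ≤ 8 ^ j * (b - a) := by
        refine (intervalIntegral.integral_mono_on hab (hint j a b) intervalIntegrable_const
          fun t _ => le j t).trans_eq ?_
        rw [intervalIntegral.integral_const, smul_eq_mul, mul_comm]
      rw [lt_div_iff₀ (by positivity)] at h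
      linarith [(abs_le.1 (hGclose j a b hab)).2]
    refine ⟨ε / 2 / 8 ^ j, by positivity, fun y hy => ?_⟩
    rw [Real.dist_eq] at hy ⊢
    rcases le_total x y with hxy | hxy
    · rw [abs_of_nonneg (sub_nonneg.2 hxy)] at hy
      rw [abs_of_nonneg (sub_nonneg.2 (hmono hxy))]
      exact key x y hxy hy
    · rw [abs_of_nonpos (sub_nonpos.2 hxy), neg_sub] at hy
      rw [abs_of_nonpos (sub_nonpos.2 (hmono hxy)), neg_sub]
      exact key y x hxy hy
  exact ⟨⟨G, hmono, fun x => hcont.continuousWithinAt⟩, hcont, fun a b _ => hGlim a b, hGclose⟩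

/-! ### Support of the limit measure and the mass distribution principle. -/

theorem stieltjes_measure_compl_eq_zero {G : StieltjesFunction ℝ} {f : ℕ → ℝ → ℝ}
    (hG : ∀ a b, a ≤ b → Tendsto (fun k => ∫ t in a..b, f k t) atTop (𝓝 (G b - G a)))
    {F : Set ℝ} (hF : IsClosed F) (hfF : ∀ᶠ k in atTop, ∀ t ∉ F, f k t = 0) :
    G.measure Fᶜ = 0 := by
  refine measure_null_of_locally_null _ fun x hx => ?_
  obtain ⟨ε, hε, hball⟩ := Metric.isOpen_iff.1 hF.isOpen_compl x hx
  refine ⟨Ioc (x - ε / 2) (x + ε / 2),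
    mem_nhdsWithin_of_mem_nhds (Ioc_mem_nhds (by linarith) (by linarith)), ?_⟩
  have hab : x - ε / 2 ≤ x + ε / 2 := by linarith
  have h0 : G (x + ε / 2) - G (x - ε / 2) = 0 := by
    refine tendsto_nhds_unique (hG _ _ hab) (tendsto_const_nhds.congr' ?_)
    filter_upwards [hfF] with k hk
    rw [intervalIntegral.integral_congr (g := fun _ => 0), intervalIntegral.integral_zero]
    intro t ht
    rw [uIcc_of_le hab] at ht
    refine hk t (hball ?_)
    rw [Metric.mem_ball, Real.dist_eq, abs_lt]
    constructor <;> linarith [ht.1, ht.2]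
  rw [G.measure_Ioc, h0, ENNReal.ofReal_zero]

/-- A bounded set lies in the closed interval from its infimum to its supremum, which has the same
diameter; continuity of `G` rules out an atom at the left endpoint. -/
theorem stieltjes_measure_le_hausdorffMeasureOf {G : StieltjesFunction ℝ} (hG : Continuous G)
    {h : ℝ≥0 → ℝ≥0} {r : ℝ} (hr : 0 < r)
    (hGh : ∀ (a : ℝ) (t : ℝ≥0), 0 < t → (t : ℝ) ≤ r → G (a + t) - G a ≤ h t) :
    G.measure ≤ hausdorffMeasureOf h := by
  refine Measure.le_mkMetric _ _ (ENNReal.ofReal r) (ENNReal.ofReal_pos.2 hr) fun s hs => ?_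
  have hfin : Metric.ediam s ≠ ∞ := ne_top_of_le_ne_top ENNReal.ofReal_ne_top hs
  have hb : Bornology.IsBounded s := Metric.isBounded_iff_ediam_ne_top.2 hfin
  rcases s.eq_empty_or_nonempty with rfl | hne
  · simp
  set a := sInf s
  set b := sSup s
  have hsub : s ⊆ Icc a b := hb.subset_Icc_sInf_sSup
  obtain ⟨x, hx⟩ := hne
  have hab : a ≤ b := (hsub hx).1.trans (hsub hx).2
  rw [if_neg hfin]
  have hd : Metric.ediam s = ENNReal.ofReal (b - a) := Real.ediam_eq hb
  rw [hd, ENNReal.ofReal_le_ofReal_iff hr.le] at hs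
  rw [hd]
  refine (measure_mono hsub).trans ?_
  have hleft : Function.leftLim G a = G a :=
    leftLim_eq_of_tendsto (hG.continuousWithinAt (s := Iio a))
  rw [G.measure_Icc, hleft]
  change _ ≤ ((h (b - a).toNNReal : ℝ≥0) : ℝ≥0∞)
  rw [ENNReal.ofReal, ENNReal.coe_le_coe, Real.toNNReal_le_iff_le_coe]
  rcases hab.eq_or_lt with hab | hab
  · simp [hab]
  · have := hGh a (b - a).toNNReal (by simpa using hab)
      (by rwa [Real.coe_toNNReal _ (sub_nonneg.2 hab.le)])
    rwa [Real.coe_toNNReal _ (sub_nonneg.2 hab.le), add_sub_cancel] at this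

theorem exists_hausdorffMeasureOf_pos {h : ℝ≥0 → ℝ≥0} (hh : IsDimensionFunction h)
    (hp : DimPrec h fun x => x) {g : ℕ → ℕ → ℝ → ℝ} {F : ℕ → ℕ → Set ℝ}
    (closed : ∀ k N, IsClosed (F k N)) (supp : ∀ k N t, g k N t ≠ 0 → t ∈ F k N)
    (tame : ∀ k N, 0 < N → IsTame fun t => unitStep t * g k N t)
    (meas : ∀ k N, Measurable (g k N)) (nonneg : ∀ k N t, 0 ≤ g k N t) (le : ∀ k N t, g k N t ≤ 8)
    (mean : ∀ k, ∃ C, ∀ N : ℕ, 0 < N → ∀ a b, a ≤ b → |∫ t in a..b, (g k N t - 1)| ≤ C / N) :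
    ∃ N : ℕ → ℕ, 0 < hausdorffMeasureOf h (Icc 0 1 ∩ ⋂ k, F k (N k)) := by
  obtain ⟨R, hRpos, hRanti, hRlim, hR0, hRh⟩ := hp.exists_scales hh
  obtain ⟨N, f, hf0, hfs, hfm, hfn, hfle, hfc⟩ := exists_density_seq tame meas nonneg le mean
    (η := fun k => R (k + 1) - R (k + 2)) fun k => sub_pos.2 (hRanti (Nat.lt_succ_self _))
  obtain ⟨G, hG, hGlim, hGclose⟩ := exists_limit_stieltjes hRpos hRlim hfm hfn hfle hfc
  have hunit (k : ℕ) (t : ℝ) (ht : t ∉ Icc (0 : ℝ) 1) : f k t = 0 := by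
    induction k with
    | zero => rw [hf0]; exact unitStep_of_notMem fun h => ht (Ioc_subset_Icc_self h)
    | succ k ih => rw [hfs, ih, zero_mul]
  have hsupp (j k : ℕ) (hk : j + 1 ≤ k) (t : ℝ) (ht : t ∉ F j (N j)) : f k t = 0 := by
    induction k, hk using Nat.le_induction with
    | base => rw [hfs, not_imp_comm.1 (supp j (N j) t) ht, mul_zero]
    | succ k _ ih => rw [hfs, ih, zero_mul]
  have hnull : G.measure (Icc 0 1 ∩ ⋂ k, F k (N k))ᶜ = 0 := by
    rw [compl_inter, compl_iInter]
    refine measure_union_null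
      (stieltjes_measure_compl_eq_zero hGlim isClosed_Icc (Eventually.of_forall hunit))
      (measure_iUnion_null fun j => stieltjes_measure_compl_eq_zero hGlim (closed _ _) ?_)
    filter_upwards [eventually_ge_atTop (j + 1)] with k hk using hsupp j k hk
  have hpos : 0 < G.measure univ := by
    refine lt_of_lt_of_le ?_ (measure_mono (subset_univ (Ioc 0 1)))
    rw [G.measure_Ioc, ENNReal.ofReal_pos]
    have h₁ : ∫ t in (0 : ℝ)..1, f 0 t = 1 := by
      rw [hf0, intervalIntegral.integral_congr_ae (g := fun _ => (1 : ℝ))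
        (ae_of_all _ fun t ht => unitStep_of_mem (by rwa [uIoc_of_le zero_le_one] at ht))]
      simp
    -- The initial mass is `1` and the total change is at most `R 1 < R 0 ≤ 1/2`.
    have h₂ := (abs_le.1 (hGclose 0 0 1 zero_le_one)).1
    rw [h₁] at h₂
    linarith [hRanti (Nat.lt_succ_self 0)]
  have hGh (a : ℝ) (t : ℝ≥0) (ht : 0 < t) (htr : (t : ℝ) ≤ R 0) : G (a + t) - G a ≤ h t := by
    -- The first scale below `t` is not `R 0`, so `t` lies in some `(R (j + 1), R j]`.
    have hex : ∃ j, R j < t := (hRlim.eventually_lt_const (by exact_mod_cast ht)).exists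
    obtain ⟨j, hj⟩ : ∃ j, Nat.find hex = j + 1 :=
      Nat.exists_eq_succ_of_ne_zero fun h0 => not_lt.2 htr (h0 ▸ Nat.find_spec hex)
    have h₁ : R (j + 1) < t := hj ▸ Nat.find_spec hex
    have h₂ : (t : ℝ) ≤ R j := not_lt.1 (Nat.find_min hex (by omega))
    have hab : a ≤ a + t := by simp
    have h₃ : ∫ s in a..(a + t), f j s ≤ 8 ^ j * t := by
      have hint : IntervalIntegrable (f j) volume a (a + t) :=
        intervalIntegrable_of_measurable_of_bounded (hfm j)
          ⟨8 ^ j, fun s => by rw [abs_of_nonneg (hfn j s)]; exact hfle j s⟩ _ _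
      refine (intervalIntegral.integral_mono_on hab hint intervalIntegrable_const
        fun s _ => hfle j s).trans_eq ?_
      rw [intervalIntegral.integral_const, smul_eq_mul, add_sub_cancel_left, mul_comm]
    linarith [(abs_le.1 (hGclose j a _ hab)).2, hRh j t ht h₂]
  refine ⟨N, ?_⟩
  have hle := stieltjes_measure_le_hausdorffMeasureOf hG (hRpos 0) hGh
  refine lt_of_lt_of_le ?_ (hle _)
  rwa [measure_of_measure_compl_eq_zero hnull]

/-! ### Sets avoiding ratios and progressions. -/

theorem exists_isCompact_avoiding {h : ℝ≥0 → ℝ≥0} (hh : IsDimensionFunction h)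
    (hp : DimPrec h fun x => x) {A : Set ℝ} (hA : A.Countable) (hA1 : A ⊆ Ioi 1) :
    ∃ E : Set ℝ, IsCompact E ∧ 0 < hausdorffMeasureOf h E ∧
      ∀ x ∈ E, ∀ y ∈ E, ∀ z ∈ E, x < y → y < z → (z - x) / (z - y) ∉ A := by
  -- Adding `2` makes the index type nonempty, so that it can be enumerated even if `A` is empty.
  have : Countable ↥(insert 2 A) := (hA.insert 2).to_subtype
  have h1 (a : ↥(insert 2 A)) : 1 < a.1 := by
    rcases a with ⟨a, rfl | ha⟩
    · norm_num
    · exact hA1 ha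
  obtain ⟨e, he⟩ := exists_surjective_nat (↥(insert 2 A) × ℚ × ℚ)
  obtain ⟨N, hN⟩ := exists_hausdorffMeasureOf_pos hh hp
    (g := fun k => sieveDensity (e k).1 (e k).2.1 (e k).2.2)
    (F := fun k => sieve (e k).1 (e k).2.1 (e k).2.2)
    (fun k => isClosed_sieve _ _ _) (fun k N t => mem_sieve_of_sieveDensity_ne_zero)
    (fun k N => isTame_unitStep_mul_sieveDensity (h1 _) _ _)
    (fun k => measurable_sieveDensity _ _ _) (fun k => sieveDensity_nonneg _ _ _)
    (fun k => sieveDensity_le _ _ _)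
    (fun k => exists_abs_integral_sieveDensity_sub_one_le (h1 _) _ _)
  refine ⟨_, isCompact_Icc.inter_right (isClosed_iInter fun k => isClosed_sieve _ _ _ (N k)), hN,
    fun x hx y hy z hz hxy hyz ha => ?_⟩
  obtain ⟨p, hxp, hpy⟩ := exists_rat_btwn hxy
  obtain ⟨q, hyq, hqz⟩ := exists_rat_btwn hyz
  obtain ⟨k, hk⟩ := he (⟨_, mem_insert_of_mem _ ha⟩, p, q)
  refine ne_of_mem_sieve (mem_iInter.1 hx.2 k) (mem_iInter.1 hy.2 k) (mem_iInter.1 hz.2 k)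
    ?_ ?_ ?_ ?_ ?_ <;> rw [hk]
  · exact hxp
  · exact hpy
  · exact hyq
  · exact hqz
  · have : z - y ≠ 0 := (sub_pos.2 hyz).ne'
    field_simp
    ring

theorem exists_isCompact_threeAPFree {h : ℝ≥0 → ℝ≥0} (hh : IsDimensionFunction h)
    (hp : DimPrec h fun x => x) :
    ∃ E : Set ℝ, IsCompact E ∧ 0 < hausdorffMeasureOf h E ∧ ThreeAPFree E := by
  obtain ⟨E, hE, hpos, hav⟩ := exists_isCompact_avoiding hh hp (countable_singleton (2 : ℝ))
    (by simp)
  refine ⟨E, hE, hpos, fun x hx y hy z hz hxyz => ?_⟩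
  -- In a progression `x < y < z` the ratio is `2`. Exchanging `x` and `z` treats decreasing
  -- progressions.
  have key {x z : ℝ} (hx : x ∈ E) (hz : z ∈ E) (h : x + z = y + y) : ¬x < y := fun hxy => by
    refine hav x hx y hy z hz hxy (by linarith) ?_
    rw [mem_singleton_iff, div_eq_iff (by linarith)]
    linarith
  have h₁ := key hx hz hxyz
  have h₂ := key hz hx (by linarith)
  linarith

/-! ### A dimension function forcing dimension one. -/

/-- With `u = 1 / t` the function is `log u / u`, which decreases for `u ≥ e`. -/
theorem monotoneOn_negMulLog : MonotoneOn Real.negMulLog (Icc 0 (Real.exp (-1))) := by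
  intro s hs t ht hst
  rcases hs.1.eq_or_lt with rfl | hs0
  · rw [Real.negMulLog_zero]
    exact Real.negMulLog_nonneg ht.1 (ht.2.trans (Real.exp_le_one_iff.2 (by norm_num)))
  · have ht0 : 0 < t := hs0.trans_le hst
    have inv_mem {x : ℝ} (hx0 : 0 < x) (hx : x ≤ Real.exp (-1)) : x⁻¹ ∈ {x | Real.exp 1 ≤ x} := by
      rw [Real.exp_neg] at hx
      exact (le_inv_comm₀ hx0 (Real.exp_pos 1)).1 hx
    have := Real.log_div_self_antitoneOn (inv_mem ht0 ht.2) (inv_mem hs0 hs.2)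
      (inv_anti₀ hs0 hst)
    simp only [Real.log_inv, div_inv_eq_mul] at this
    rw [Real.negMulLog, Real.negMulLog]
    linarith

/-- The dimension function `t ↦ -t log t`, made constant beyond the point `1 / e`. -/
noncomputable def entropyDim (t : ℝ≥0) : ℝ≥0 :=
  (Real.negMulLog (min t (Real.exp (-1)))).toNNReal

theorem negMulLog_min_nonneg (t : ℝ≥0) : 0 ≤ Real.negMulLog (min t (Real.exp (-1))) :=
  Real.negMulLog_nonneg (le_min t.2 (Real.exp_pos _).le)
    ((min_le_right _ _).trans (Real.exp_le_one_iff.2 (by norm_num)))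

theorem isDimensionFunction_entropyDim : IsDimensionFunction entropyDim where
  map_zero := by simp [entropyDim, (Real.exp_pos _).le]
  pos t ht := by
    have h₀ : 0 < min (t : ℝ) (Real.exp (-1)) := lt_min ht (Real.exp_pos _)
    have h₁ : min (t : ℝ) (Real.exp (-1)) < 1 :=
      (min_le_right _ _).trans_lt (by rw [Real.exp_lt_one_iff]; norm_num)
    rw [entropyDim, Real.toNNReal_pos, Real.negMulLog, neg_mul, neg_pos]
    exact mul_neg_of_pos_of_neg h₀ (Real.log_neg h₀ h₁)
  mono s t hst := Real.toNNReal_le_toNNReal <| monotoneOn_negMulLog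
    ⟨le_min s.2 (Real.exp_pos _).le, min_le_right _ _⟩
    ⟨le_min t.2 (Real.exp_pos _).le, min_le_right _ _⟩ (min_le_min_right _ hst)
  right_continuous t := by
    have : Continuous entropyDim := continuous_real_toNNReal.comp
      (Real.continuous_negMulLog.comp (by fun_prop))
    exact this.continuousWithinAt

theorem coe_entropyDim {t : ℝ≥0} (ht : (t : ℝ) ≤ Real.exp (-1)) :
    (entropyDim t : ℝ) = Real.negMulLog t := by
  have := negMulLog_min_nonneg t
  rw [min_eq_left ht] at this
  rw [entropyDim, min_eq_left ht, Real.coe_toNNReal _ this]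

theorem eventually_le_exp_neg_one : ∀ᶠ t : ℝ≥0 in 𝓝 0, (t : ℝ) ≤ Real.exp (-1) := by
  have : Tendsto (fun t : ℝ≥0 => (t : ℝ)) (𝓝 0) (𝓝 0) := NNReal.continuous_coe.tendsto 0
  exact this.eventually_le_const (Real.exp_pos _)

theorem dimPrec_entropyDim : DimPrec entropyDim fun x => x := by
  rw [DimPrec, ← NNReal.tendsto_coe]
  have h₁ : Tendsto (fun t : ℝ≥0 => (t : ℝ)) (𝓝[>] 0) (𝓝[>] 0) :=
    tendsto_nhdsWithin_iff.2 ⟨(NNReal.continuous_coe.tendsto 0).mono_left nhdsWithin_le_nhds,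
      eventually_mem_nhdsWithin.mono fun t ht => ht⟩
  have h₂ := (tendsto_neg_atBot_atTop.comp
    (Real.tendsto_log_nhdsGT_zero.comp h₁)).inv_tendsto_atTop
  refine h₂.congr' ?_
  filter_upwards [self_mem_nhdsWithin, nhdsWithin_le_nhds eventually_le_exp_neg_one] with t ht hte
  have ht' : (t : ℝ) ≠ 0 := NNReal.coe_ne_zero.2 (ne_of_gt ht)
  rw [NNReal.coe_div, coe_entropyDim hte, Real.negMulLog]
  simp only [Pi.inv_apply, Function.comp_apply]
  rw [neg_mul_comm, div_mul_cancel_left₀ ht']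

/-- This is `log u ≤ u ^ ε / ε` with `u = 1 / t` and `ε = 1 - s`. -/
theorem entropyDim_le {s : ℝ} (hs : s < 1) {t : ℝ≥0} (ht : (t : ℝ) ≤ Real.exp (-1)) :
    (entropyDim t : ℝ) ≤ (1 - s)⁻¹ * (t : ℝ) ^ s := by
  rw [coe_entropyDim ht]
  rcases t.2.eq_or_lt with h0 | h0
  · replace h0 : (t : ℝ) = 0 := h0.symm
    rw [h0, Real.negMulLog_zero]
    exact mul_nonneg (inv_nonneg.2 (by linarith)) (Real.rpow_nonneg le_rfl _)
  · replace h0 : 0 < (t : ℝ) := h0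
    have := Real.log_le_rpow_div (inv_nonneg.2 h0.le) (sub_pos.2 hs)
    rw [Real.log_inv, Real.inv_rpow h0.le, ← Real.rpow_neg h0.le, neg_sub,
      Real.rpow_sub_one h0.ne'] at this
    calc Real.negMulLog t = t * -Real.log t := by rw [Real.negMulLog]; ring
      _ ≤ t * ((t : ℝ) ^ s / t / (1 - s)) := mul_le_mul_of_nonneg_left this h0.le
      _ = _ := by field_simp

/-- For `s < 1` the gauge is at most a constant times `t ^ s` near `0`, so a null `s`-dimensional
measure would make the `entropyDim` measure null. -/
theorem one_le_dimH_of_hausdorffMeasureOf_entropyDim_pos {E : Set ℝ}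
    (hE : 0 < hausdorffMeasureOf entropyDim E) : 1 ≤ dimH E := by
  refine ENNReal.le_of_forall_nnreal_lt fun s hs => le_dimH_of_hausdorffMeasure_ne_zero fun h0 => ?_
  have hs1 : s < 1 := by exact_mod_cast hs
  have hsr : (s : ℝ) < 1 := by exact_mod_cast hs1
  set c : ℝ≥0 := (1 - s)⁻¹
  have hc : (c : ℝ) = (1 - (s : ℝ))⁻¹ := by simp [c, NNReal.coe_sub hs1.le]
  have hc0 : c ≠ 0 := inv_ne_zero (tsub_pos_of_lt hs1).ne'
  have hle : hausdorffMeasureOf entropyDim ≤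
      (c : ℝ≥0∞) • (Measure.hausdorffMeasure s : Measure ℝ) := by
    refine Measure.mkMetric_mono_smul ENNReal.coe_ne_top (by exact_mod_cast hc0) ?_
    have hev : ∀ᶠ r : ℝ≥0∞ in 𝓝 0, r ≤ ENNReal.ofReal (Real.exp (-1)) :=
      eventually_le_nhds (ENNReal.ofReal_pos.2 (Real.exp_pos _))
    refine nhdsWithin_le_nhds (hev.mono fun r hr => ?_)
    have hr' : r ≠ ∞ := ne_top_of_le_ne_top ENNReal.ofReal_ne_top hr
    lift r to ℝ≥0 using hr'
    have hre : (r : ℝ) ≤ Real.exp (-1) := by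
      rw [← ENNReal.ofReal_coe_nnreal, ENNReal.ofReal_le_ofReal_iff (Real.exp_pos _).le] at hr
      exact hr
    simp only [ENNReal.coe_ne_top, if_false, ENNReal.toNNReal_coe, Pi.smul_apply, smul_eq_mul]
    rw [← ENNReal.coe_rpow_of_nonneg _ s.coe_nonneg, ← ENNReal.coe_mul, ENNReal.coe_le_coe,
      ← NNReal.coe_le_coe, NNReal.coe_mul, NNReal.coe_rpow, hc]
    exact entropyDim_le hsr hre
  have h₁ := hle E
  rw [Measure.smul_apply, h0, smul_zero] at h₁
  exact hE.not_ge h₁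

theorem mainTheorem5 :
    (∀ h : ℝ≥0 → ℝ≥0, IsDimensionFunction h → DimPrec h (fun x => x) →
      ∀ A : Set ℝ, A.Countable → A ⊆ Ioi 1 →
        ∃ E : Set ℝ, IsCompact E ∧ 0 < hausdorffMeasureOf h E ∧
          ∀ x ∈ E, ∀ y ∈ E, ∀ z ∈ E, x < y → y < z → (z - x) / (z - y) ∉ A) ∧
    (∀ h : ℝ≥0 → ℝ≥0, IsDimensionFunction h → DimPrec h (fun x => x) →
        ∃ E : Set ℝ, IsCompact E ∧ 0 < hausdorffMeasureOf h E ∧ ThreeAPFree E) ∧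
    (∃ E : Set ℝ, IsCompact E ∧ dimH E = 1 ∧ ThreeAPFree E) := by
  refine ⟨fun h hh hp A hA hA1 => exists_isCompact_avoiding hh hp hA hA1,
    fun h hh hp => exists_isCompact_threeAPFree hh hp, ?_⟩
  obtain ⟨E, hE, hpos, hfree⟩ :=
    exists_isCompact_threeAPFree isDimensionFunction_entropyDim dimPrec_entropyDim
  refine ⟨E, hE, le_antisymm ?_ (one_le_dimH_of_hausdorffMeasureOf_entropyDim_pos hpos), hfree⟩
  exact Real.dimH_univ ▸ dimH_mono (subset_univ E)
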